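/- A Čech closure operator on a set $X$ is a map $c:\mathcal P(X)\to\mathcal P(X)$ with $c(\emptyset)=\emptyset$, $A\subseteq c(A)$ and $c(A\cup B)=c(A)\cup c(B)$; a set $U$ is a neighborhood of a point $x$ in $(X,c)$ if $x\notin c(X\setminus U)$. A map $f:(X,c)\to(Y,c')$ is continuous if $f(c(A))\subseteq c'(f(A))$ for all $A\subseteq X$. The product closure operator on $X\times Y$ puts a point $p=(x,y)$ in the closure of $A$ if and only if $U\times V$ meets $A$ for all neighborhoods $U$ of $x$ and $V$ of $y$. Let $I=[0,1]$ carry its topological closure operator. For a closure space $(X,c)$ and a point $*\in X$, let $\pi_1((X,c),*)$ be the fundamental group: the set of continuous maps $f:I\to(X,c)$ with $f(0)=f(1)=*$, modulo homotopy rel $\{0,1\}$ (homotopies being continuous maps $I\times I\to(X,c)$, where $I\times I$ carries the product closure operator), with the product $[f][g]=[f\star g]$ induced by concatenation (first $f$, then $g$). Let $S^1=\mathbb R/\mathbb Z$ be the circle of circumference $1$ with the arc-length metric $d([x],[y])=\min_{n\in\mathbb Z}|x-y-n|$. For a real number $r\ge 0$ let $c_r$ be the closure operator on $S^1$ given by $c_r(A)=\{x\in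 S^1: d(x,A)\le r\}$, where $d(x,A)=\inf_{y\in A}d(x,y)$ and $d(x,\emptyset)=\infty$. Then, for every $r$ with $0\le r<1/3$ and every base point $*\in S^1$, there is a group isomorphism $$\pi_1\big((S^1,c_r),*\big)\cong\mathbb Z .$$ -/

import Mathlib

/-- A Čech closure operator on a set `X`. It need not be idempotent. -/
structure CechClosure (X : Type*) where
  cl : Set X → Set X
  cl_empty : cl ∅ = ∅
  subset_cl : ∀ A, A ⊆ cl A
  cl_union : ∀ A B, cl (A ∪ B) = cl A ∪ cl B

namespace CechClosure

theorem cl_mono {X : Type*} (c : CechClosure X) {A B : Set X} (h : A ⊆ B) : c.cl A ⊆ c.cl B := by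
  have := c.cl_union A B
  rw [Set.union_eq_self_of_subset_left h] at this
  rw [this]
  exact Set.subset_union_left

/-- `U` is a neighborhood of the point `x`, i.e. `x ∈ X \ c (X \ U)`. -/
def IsNhd {X : Type*} (c : CechClosure X) (U : Set X) (x : X) : Prop := x ∉ c.cl Uᶜ

theorem IsNhd.inter {X : Type*} {c : CechClosure X} {U V : Set X} {x : X}
    (hU : c.IsNhd U x) (hV : c.IsNhd V x) : c.IsNhd (U ∩ V) x := by
  unfold IsNhd at *
  rw [Set.compl_inter, c.cl_union]
  exact fun h => h.elim hU hV

theorem IsNhd.mem {X : Type*} {c : CechClosure X} {U : Set X} {x : X}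
    (hU : c.IsNhd U x) : x ∈ U := by
  by_contra h
  exact hU (c.subset_cl _ h)

theorem isNhd_univ {X : Type*} (c : CechClosure X) (x : X) : c.IsNhd Set.univ x := by
  simp [IsNhd, c.cl_empty]

/-- The closure operator of a topological space. -/
def ofTop (X : Type*) [TopologicalSpace X] : CechClosure X where
  cl := closure
  cl_empty := closure_empty
  subset_cl _ := subset_closure
  cl_union _ _ := closure_union

/-- The closure operator `c_r` of a metric space: `c_r A` is the set of all points `x` with
`d(x, A) ≤ r`, where `d(x, A)` is the infimum of the distances from `x` to the points of `A`
(and `d(x, ∅) = ∞`). -/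
noncomputable def ofMetric (X : Type*) [MetricSpace X] (r : NNReal) : CechClosure X where
  cl A := {x | Metric.infEDist x A ≤ (r : ENNReal)}
  cl_empty := by simp
  subset_cl A x hx := by simp [Metric.infEDist_zero_of_mem hx]
  cl_union A B := by
    ext x
    simp [Metric.infEDist_union]

/-- The product closure operator: a point is in the closure of `A` if and only if every box
`U × V` of neighborhoods of its coordinates meets `A`. -/
def prod {X Y : Type*} (c : CechClosure X) (d : CechClosure Y) : CechClosure (X × Y) where
  cl A := {p | ∀ U V, c.IsNhd U p.1 → d.IsNhd V p.2 → ((U ×ˢ V) ∩ A).Nonempty}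
  cl_empty := by
    ext p
    simp only [Set.inter_empty, Set.not_nonempty_empty, Set.mem_ofPred_eq, Set.mem_empty_iff_false,
      iff_false]
    exact fun h => h _ _ (c.isNhd_univ _) (d.isNhd_univ _)
  subset_cl A p hp U V hU hV := ⟨p, ⟨hU.mem, hV.mem⟩, hp⟩
  cl_union A B := by
    ext p
    constructor
    · intro h
      by_contra hn
      simp only [Set.mem_union, Set.mem_ofPred_eq, not_or, not_forall] at hn
      obtain ⟨⟨U, V, hU, hV, h1⟩, U', V', hU', hV', h2⟩ := hn
      obtain ⟨q, ⟨⟨hq1, hq1'⟩, hq2, hq2'⟩, hq | hq⟩ := h _ _ (hU.inter hU') (hV.inter hV')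
      · exact h1 ⟨q, ⟨hq1, hq2⟩, hq⟩
      · exact h2 ⟨q, ⟨hq1', hq2'⟩, hq⟩
    · rintro (h | h) U V hU hV
      · obtain ⟨q, hq, hA⟩ := h U V hU hV
        exact ⟨q, hq, Or.inl hA⟩
      · obtain ⟨q, hq, hB⟩ := h U V hU hV
        exact ⟨q, hq, Or.inr hB⟩

/-- Continuity of a map of closure spaces `(X, c) → (Y, d)`. -/
def Cont {X Y : Type*} (c : CechClosure X) (d : CechClosure Y) (f : X → Y) : Prop :=
  ∀ A : Set X, f '' c.cl A ⊆ d.cl (f '' A)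

/-- Homotopy rel `S` of maps `(X, c) → (Y, d)`; the interval carries its topological closure
operator and `X × I` the product closure operator. -/
def HomotopicRel {X Y : Type*} (c : CechClosure X) (d : CechClosure Y) (f g : X → Y)
    (S : Set X) : Prop :=
  ∃ H : X × unitInterval → Y, Cont (c.prod (ofTop unitInterval)) d H ∧
    (∀ x, H (x, 0) = f x) ∧ (∀ x, H (x, 1) = g x) ∧
    ∀ x ∈ S, ∀ t, H (x, t) = f x ∧ H (x, t) = g x

theorem isNhd_ofTop {X : Type*} [TopologicalSpace X] {U : Set X} {x : X} :
    (ofTop X).IsNhd U x ↔ U ∈ nhds x := by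
  change x ∉ closure Uᶜ ↔ _
  rw [closure_compl, Set.mem_compl_iff, not_not, mem_interior_iff_mem_nhds]

theorem prod_ofTop (X Y : Type*) [TopologicalSpace X] [TopologicalSpace Y] :
    (ofTop X).prod (ofTop Y) = ofTop (X × Y) := by
  have key : ∀ A, ((ofTop X).prod (ofTop Y)).cl A = (ofTop (X × Y)).cl A := by
    intro A
    ext p
    change (∀ U V, (ofTop X).IsNhd U p.1 → (ofTop Y).IsNhd V p.2 → ((U ×ˢ V) ∩ A).Nonempty) ↔
      p ∈ closure A
    simp only [isNhd_ofTop, mem_closure_iff_nhds]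
    constructor
    · intro h W hW
      obtain ⟨U, hU, V, hV, hs⟩ := mem_nhds_prod_iff.1 hW
      exact (h U V hU hV).mono (Set.inter_subset_inter_left _ hs)
    · intro h U V hU hV
      exact h _ (prod_mem_nhds hU hV)
  have e : ∀ a b : CechClosure (X × Y), a.cl = b.cl → a = b := by
    rintro ⟨⟩ ⟨⟩ rfl
    rfl
  exact e _ _ (funext key)

theorem Cont.comp {X Y Z : Type*} {c : CechClosure X} {d : CechClosure Y} {e : CechClosure Z}
    {g : Y → Z} {f : X → Y} (hg : Cont d e g) (hf : Cont c d f) :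
    Cont c e (fun x => g (f x)) := by
  rintro A _ ⟨x, hx, rfl⟩
  have := hg _ ⟨f x, hf A ⟨x, hx, rfl⟩, rfl⟩
  rwa [Set.image_image] at this

theorem cont_ofTop {X Y : Type*} [TopologicalSpace X] [TopologicalSpace Y] {f : X → Y}
    (hf : Continuous f) : Cont (ofTop X) (ofTop Y) f :=
  fun _ => image_closure_subset_closure_image hf

theorem cont_const {X Y : Type*} (c : CechClosure X) (d : CechClosure Y) (y : Y) :
    Cont c d (fun _ => y) := by
  rintro A _ ⟨x, hx, rfl⟩
  apply d.subset_cl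
  rcases A.eq_empty_or_nonempty with rfl | ⟨a, ha⟩
  · rw [c.cl_empty] at hx
    exact hx.elim
  · exact ⟨a, ha, rfl⟩

/-- Pasting two continuous maps along the closed sets `u ≤ a` and `a ≤ u`. -/
theorem cont_ite {T X : Type*} [TopologicalSpace T] {c : CechClosure X} {f g : T → X} {u : T → ℝ}
    (a : ℝ) (hu : Continuous u) (hf : Cont (ofTop T) c f) (hg : Cont (ofTop T) c g)
    (h : ∀ t, u t = a → f t = g t) : Cont (ofTop T) c (fun t => if u t ≤ a then f t else g t) := by
  rintro A _ ⟨t, ht, rfl⟩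
  have hA : A = A ∩ {s | u s ≤ a} ∪ A ∩ {s | a ≤ u s} := by
    ext s
    have := le_total (u s) a
    simp only [Set.mem_union, Set.mem_inter_iff, Set.mem_ofPred_eq]
    tauto
  change t ∈ closure A at ht
  rw [hA, closure_union] at ht
  rcases ht with ht | ht
  · have h1 : u t ≤ a := by
      have := closure_mono (Set.inter_subset_right) ht
      rwa [(isClosed_le hu continuous_const).closure_eq] at this
    have h2 := hf _ ⟨t, ht, rfl⟩
    simp only [h1, if_true]
    refine c.cl_mono ?_ h2
    rintro _ ⟨s, ⟨hs, hs'⟩, rfl⟩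
    exact ⟨s, hs, if_pos hs'⟩
  · have h1 : a ≤ u t := by
      have := closure_mono (Set.inter_subset_right) ht
      rwa [(isClosed_le continuous_const hu).closure_eq] at this
    have h2 := hg _ ⟨t, ht, rfl⟩
    have hite : ∀ s, a ≤ u s → (if u s ≤ a then f s else g s) = g s := by
      intro s hs
      split_ifs with h'
      · exact h s (le_antisymm h' hs)
      · rfl
    change (if u t ≤ a then f t else g t) ∈ _
    rw [hite t h1]
    refine c.cl_mono ?_ h2
    rintro _ ⟨s, ⟨hs, hs'⟩, rfl⟩
    exact ⟨s, hs, hite s hs'⟩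

/-- Loops in `(X, c)` at `x`: continuous maps `I → (X, c)` that send both end points to `x`. -/
structure Loop {X : Type*} (c : CechClosure X) (x : X) where
  toFun : unitInterval → X
  cont : Cont (ofTop unitInterval) c toFun
  zero : toFun 0 = x
  one : toFun 1 = x

/-- The retraction of the real line onto the unit interval. -/
noncomputable def clamp : ℝ → unitInterval := Set.projIcc 0 1 zero_le_one

theorem continuous_clamp : Continuous clamp := continuous_projIcc

theorem clamp_of_le {u : ℝ} (h : u ≤ 0) : clamp u = 0 := Set.projIcc_of_le_left _ h

theorem clamp_of_ge {u : ℝ} (h : 1 ≤ u) : clamp u = 1 := Set.projIcc_of_right_le _ h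

theorem clamp_coe (t : unitInterval) : clamp (t : ℝ) = t := Set.projIcc_val _ t

namespace Loop

variable {X : Type*} {c : CechClosure X} {x : X}

/-- The concatenation `f ⋆ g`: it runs through `f` on `[0, 1/2]` and through `g` on `[1/2, 1]`.
(On these intervals `clamp` is the identity on the arguments that occur.) -/
noncomputable def star (f g : Loop c x) : Loop c x where
  toFun t := if (t : ℝ) ≤ 1 / 2 then f.toFun (clamp (2 * t)) else g.toFun (clamp (2 * t - 1))
  cont := by
    refine cont_ite (1 / 2) continuous_subtype_val
      (f.cont.comp (cont_ofTop (continuous_clamp.comp (by fun_prop))))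
      (g.cont.comp (cont_ofTop (continuous_clamp.comp (by fun_prop)))) ?_
    intro t ht
    rw [clamp_of_ge (by linarith), clamp_of_le (by linarith), f.one, g.zero]
  zero := by
    simp [clamp_of_le, f.zero]
  one := by
    rw [if_neg (by norm_num), clamp_of_ge (by norm_num), g.one]

/-- The constant loop. -/
def const (c : CechClosure X) (x : X) : Loop c x where
  toFun _ := x
  cont := cont_const _ _ _
  zero := rfl
  one := rfl

/-- The reversed loop. -/
def reverse (f : Loop c x) : Loop c x where
  toFun t := f.toFun (unitInterval.symm t)
  cont := f.cont.comp (cont_ofTop unitInterval.continuous_symm)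
  zero := by simp [f.one]
  one := by simp [f.zero]

/-- Homotopy of loops rel end points. -/
def Homotopic (f g : Loop c x) : Prop :=
  HomotopicRel (ofTop unitInterval) c f.toFun g.toFun {0, 1}

theorem homotopic_iff (f g : Loop c x) : f.Homotopic g ↔
    ∃ H : unitInterval × unitInterval → X, Cont (ofTop (unitInterval × unitInterval)) c H ∧
      (∀ s, H (s, 0) = f.toFun s) ∧ (∀ s, H (s, 1) = g.toFun s) ∧
      ∀ t, H (0, t) = x ∧ H (1, t) = x := by
  unfold Homotopic HomotopicRel
  rw [prod_ofTop]
  simp [f.zero, f.one, g.zero, g.one, forall_and]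

/-- Two reparametrizations of a map on the real line are homotopic. -/
theorem homotopic_of_param (f g : Loop c x) (F : ℝ → X) (hF : Cont (ofTop ℝ) c F)
    (p q : ℝ → ℝ) (hp : Continuous p) (hq : Continuous q)
    (hf : ∀ s : unitInterval, f.toFun s = F (p s)) (hg : ∀ s : unitInterval, g.toFun s = F (q s))
    (h0 : p 0 = q 0) (h1 : p 1 = q 1) : f.Homotopic g := by
  rw [homotopic_iff]
  refine ⟨fun z => F ((1 - (z.2 : ℝ)) * p z.1 + z.2 * q z.1), hF.comp (cont_ofTop (by fun_prop)),
    ?_, ?_, ?_⟩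
  · intro s
    simp [hf]
  · intro s
    simp [hg]
  · intro t
    have e0 := hf 0
    have e1 := hf 1
    rw [f.zero] at e0
    rw [f.one] at e1
    simp only [Set.Icc.coe_zero, Set.Icc.coe_one] at *
    rw [← h0, ← h1]
    constructor
    · rw [e0]; congr 1; ring
    · rw [e1]; congr 1; ring

theorem Homotopic.refl (f : Loop c x) : f.Homotopic f :=
  homotopic_of_param f f (fun u => f.toFun (clamp u)) (f.cont.comp (cont_ofTop continuous_clamp))
    id id continuous_id continuous_id (fun s => by simp [clamp_coe]) (fun s => by simp [clamp_coe])
    rfl rfl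

theorem Homotopic.symm {f g : Loop c x} (h : f.Homotopic g) : g.Homotopic f := by
  rw [homotopic_iff] at *
  obtain ⟨H, hc, h0, h1, hb⟩ := h
  exact ⟨fun z => H (z.1, unitInterval.symm z.2), hc.comp (cont_ofTop (by fun_prop)),
    fun s => by simp [h1], fun s => by simp [h0], fun t => hb _⟩

theorem Homotopic.trans {f g h : Loop c x} (h₁ : f.Homotopic g) (h₂ : g.Homotopic h) :
    f.Homotopic h := by
  rw [homotopic_iff] at *
  obtain ⟨H, hc, h0, h1, hb⟩ := h₁
  obtain ⟨K, kc, k0, k1, kb⟩ := h₂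
  refine ⟨fun z => if (z.2 : ℝ) ≤ 1 / 2 then H (z.1, clamp (2 * z.2))
    else K (z.1, clamp (2 * z.2 - 1)), ?_, ?_, ?_, ?_⟩
  · refine cont_ite (1 / 2) (by fun_prop)
      (hc.comp (cont_ofTop (continuous_fst.prodMk (continuous_clamp.comp (by fun_prop)))))
      (kc.comp (cont_ofTop (continuous_fst.prodMk (continuous_clamp.comp (by fun_prop))))) ?_
    intro z hz
    rw [clamp_of_ge (by linarith), clamp_of_le (by linarith), h1, k0]
  · intro s
    simp [clamp_of_le, h0]
  · intro s
    simp only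
    rw [if_neg (by norm_num), clamp_of_ge (by norm_num), k1]
  · intro t
    constructor
    · simp only [(hb _).1, (kb _).1, ite_self]
    · simp only [(hb _).2, (kb _).2, ite_self]

theorem Homotopic.star {f f' g g' : Loop c x} (h₁ : f.Homotopic f') (h₂ : g.Homotopic g') :
    (f.star g).Homotopic (f'.star g') := by
  rw [homotopic_iff] at *
  obtain ⟨H, hc, h0, h1, hb⟩ := h₁
  obtain ⟨K, kc, k0, k1, kb⟩ := h₂
  refine ⟨fun z => if (z.1 : ℝ) ≤ 1 / 2 then H (clamp (2 * z.1), z.2)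
    else K (clamp (2 * z.1 - 1), z.2), ?_, ?_, ?_, ?_⟩
  · refine cont_ite (1 / 2) (by fun_prop)
      (hc.comp (cont_ofTop ((continuous_clamp.comp (by fun_prop)).prodMk continuous_snd)))
      (kc.comp (cont_ofTop ((continuous_clamp.comp (by fun_prop)).prodMk continuous_snd))) ?_
    intro z hz
    rw [clamp_of_ge (by linarith), clamp_of_le (by linarith), (hb _).2, (kb _).1]
  · intro s
    simp [Loop.star, h0, k0]
  · intro s
    simp [Loop.star, h1, k1]
  · intro t
    constructor
    · simp [clamp_of_le, (hb _).1]
    · simp only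
      rw [if_neg (by norm_num), clamp_of_ge (by norm_num), (kb _).2]

theorem Homotopic.reverse {f g : Loop c x} (h : f.Homotopic g) :
    f.reverse.Homotopic g.reverse := by
  rw [homotopic_iff] at *
  obtain ⟨H, hc, h0, h1, hb⟩ := h
  exact ⟨fun z => H (unitInterval.symm z.1, z.2), hc.comp (cont_ofTop (by fun_prop)),
    fun s => h0 _, fun s => h1 _, fun t => by simp [hb]⟩

theorem const_star (f : Loop c x) : ((const c x).star f).Homotopic f := by
  refine homotopic_of_param _ _ (fun u => f.toFun (clamp u))
    (f.cont.comp (cont_ofTop continuous_clamp)) (fun s => max 0 (2 * s - 1)) id (by fun_prop)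
    (by fun_prop) ?_ (fun s => by simp [clamp_coe]) (by norm_num) (by norm_num)
  intro s
  simp only [star, const]
  split_ifs with h
  · rw [max_eq_left (by linarith), clamp_of_le le_rfl, f.zero]
  · rw [max_eq_right (by linarith)]

theorem star_const (f : Loop c x) : (f.star (const c x)).Homotopic f := by
  refine homotopic_of_param _ _ (fun u => f.toFun (clamp u))
    (f.cont.comp (cont_ofTop continuous_clamp)) (fun s => min 1 (2 * s)) id (by fun_prop)
    (by fun_prop) ?_ (fun s => by simp [clamp_coe]) (by norm_num) (by norm_num)
  intro s
  simp only [star, const]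
  split_ifs with h
  · rw [min_eq_right (by linarith)]
  · rw [min_eq_left (by linarith), clamp_of_ge le_rfl, f.one]

theorem reverse_star (f : Loop c x) : (f.reverse.star f).Homotopic (const c x) := by
  refine homotopic_of_param _ _ (fun u => f.toFun (clamp u))
    (f.cont.comp (cont_ofTop continuous_clamp)) (fun s => |1 - 2 * s|) (fun _ => 1) (by fun_prop)
    (by fun_prop) ?_ (fun s => by simp [const, clamp_of_ge, f.one]) (by norm_num) (by norm_num)
  intro s
  simp only [star, reverse]
  have hs := s.2.1
  split_ifs with h
  · rw [abs_of_nonneg (by linarith)]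
    congr 1
    have e : clamp (2 * s) = (⟨2 * s, by linarith, by linarith⟩ : unitInterval) :=
      clamp_coe (⟨2 * s, by linarith, by linarith⟩ : unitInterval)
    rw [e, ← clamp_coe (unitInterval.symm _)]
    rfl
  · rw [abs_of_nonpos (by linarith)]
    congr 2
    ring

theorem star_assoc (f g h : Loop c x) :
    ((f.star g).star h).Homotopic (f.star (g.star h)) := by
  have hf : Cont (ofTop ℝ) c (fun u => if u ≤ 1 then f.toFun (clamp u) else
      if u ≤ 2 then g.toFun (clamp (u - 1)) else h.toFun (clamp (u - 2))) := by
    refine cont_ite 1 continuous_id (f.cont.comp (cont_ofTop continuous_clamp))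
      (cont_ite 2 continuous_id
        (g.cont.comp (cont_ofTop (continuous_clamp.comp (by fun_prop))))
        (h.cont.comp (cont_ofTop (continuous_clamp.comp (by fun_prop)))) ?_) ?_
    · rintro t rfl
      rw [clamp_of_ge (by norm_num), clamp_of_le (by norm_num), g.one, h.zero]
    · rintro t rfl
      rw [clamp_of_ge (by norm_num), if_pos (by norm_num), clamp_of_le (by norm_num), f.one, g.zero]
  have hcl : ∀ u : ℝ, 0 ≤ u → u ≤ 1 → ((clamp u : unitInterval) : ℝ) = u := by
    intro u h0 h1
    exact congrArg Subtype.val (clamp_coe (⟨u, h0, h1⟩ : unitInterval))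
  refine homotopic_of_param _ _ _ hf (fun s => min (4 * s) (2 * s + 1))
    (fun s => max (2 * s) (4 * s - 1)) (by fun_prop) (by fun_prop) ?_ ?_ (by norm_num)
    (by norm_num)
  · intro s
    have hs := s.2.1
    have hs' := s.2.2
    simp only [star]
    by_cases h1 : (s : ℝ) ≤ 1 / 2
    · rw [if_pos h1, min_eq_left (by linarith), hcl _ (by linarith) (by linarith)]
      by_cases h2 : (s : ℝ) ≤ 1 / 4
      · rw [if_pos (by linarith), if_pos (by linarith)]
        congr 2; ring
      · rw [if_neg (by linarith), if_neg (by linarith), if_pos (by linarith)]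
        congr 2; ring
    · rw [if_neg h1, min_eq_right (by linarith), if_neg (by linarith), if_neg (by linarith)]
      congr 2; ring
  · intro s
    have hs := s.2.1
    have hs' := s.2.2
    simp only [star]
    by_cases h1 : (s : ℝ) ≤ 1 / 2
    · rw [if_pos h1, max_eq_left (by linarith), if_pos (by linarith)]
    · rw [if_neg h1, max_eq_right (by linarith), hcl _ (by linarith) (by linarith),
        if_neg (show ¬ (4 * (s : ℝ) - 1 ≤ 1) by linarith)]
      by_cases h2 : (s : ℝ) ≤ 3 / 4
      · rw [if_pos (by linarith), if_pos (by linarith)]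
        congr 2; ring
      · rw [if_neg (by linarith), if_neg (by linarith)]
        congr 2; ring

end Loop

/-- Homotopy rel end points as an equivalence relation on loops. -/
def loopSetoid {X : Type*} (c : CechClosure X) (x : X) : Setoid (Loop c x) where
  r := Loop.Homotopic
  iseqv := ⟨Loop.Homotopic.refl, Loop.Homotopic.symm, Loop.Homotopic.trans⟩

/-- The fundamental group `π₁(X, x)` of the closure space `(X, c)`: loops at `x` modulo homotopy
rel end points. -/
def FundGroup {X : Type*} (c : CechClosure X) (x : X) : Type _ := Quotient (loopSetoid c x)

/-- The group structure `[v] [w] = [v ⋆ w]`. -/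
noncomputable instance FundGroup.instGroup {X : Type*} (c : CechClosure X) (x : X) :
    Group (FundGroup c x) where
  mul a b := Quotient.map₂ Loop.star
    (fun _ _ h₁ _ _ h₂ => Loop.Homotopic.star h₁ h₂) a b
  one := Quotient.mk (loopSetoid c x) (Loop.const c x)
  inv a := Quotient.map Loop.reverse (fun _ _ h => Loop.Homotopic.reverse h) a
  mul_assoc := by
    rintro ⟨f⟩ ⟨g⟩ ⟨h⟩
    exact Quotient.sound (Loop.star_assoc f g h)
  one_mul := by
    rintro ⟨f⟩
    exact Quotient.sound (Loop.const_star f)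
  mul_one := by
    rintro ⟨f⟩
    exact Quotient.sound (Loop.star_const f)
  inv_mul_cancel := by
    rintro ⟨f⟩
    exact Quotient.sound (Loop.reverse_star f)

end CechClosure

/-! Covering theory for `ℝ → ℝ/ℤ` survives when both sides carry `c_r`, where continuity allows
jumps of size up to `r`. Existence of lifts is the heart (`exists_isLift`). A `c_r`-continuous `f`
on a compact Hausdorff space is corrected by a real function `D`, averaging over a partition of
unity the small displacements from `f` to finitely many of its values, so that `f + D` is genuinely
continuous. Lift that and subtract `D`. The bound `r < 1/3` enters because minimal displacements
among three points pairwise closer than `1/3` add up exactly.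

Two lifts of one map differ by an integer-valued function with jumps below `1`, hence by a constant
on a connected domain (`IsLift.sub_eq_sub`). So the end point difference of a lift is a homotopy
invariant of loops (`Homotopic.isLift_sub_eq`). It is a complete one, since lifts with common end
points are joined by a straight-line homotopy (`homotopic_of_isLift`). The constant-speed loops thus
represent each class exactly once. -/

open Topology Filter

/-! ### Real representatives of points of the circle -/

namespace AddCircle

theorem norm_coe_le_abs (a : ℝ) : ‖(a : AddCircle (1 : ℝ))‖ ≤ |a| :=
  QuotientAddGroup.norm_mk_le_norm

theorem exists_coe_eq_abs_eq_norm (y : AddCircle (1 : ℝ)) :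
    ∃ a : ℝ, (a : AddCircle (1 : ℝ)) = y ∧ |a| = ‖y‖ := by
  obtain ⟨b, rfl⟩ := QuotientAddGroup.mk_surjective y
  refine ⟨b - round b, ?_, (UnitAddCircle.norm_eq (x := b)).symm⟩
  have h : ((round b : ℝ) : AddCircle (1 : ℝ)) = 0 :=
    (coe_eq_zero_iff (1 : ℝ)).2 ⟨round b, by simp⟩
  rw [coe_sub, h, sub_zero]

theorem coe_intCast (n : ℤ) : ((n : ℝ) : AddCircle (1 : ℝ)) = 0 :=
  (coe_eq_zero_iff (1 : ℝ)).2 ⟨n, by simp⟩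

theorem exists_intCast_eq {a b : ℝ} (h : (a : AddCircle (1 : ℝ)) = b) : ∃ n : ℤ, a - b = n := by
  obtain ⟨n, hn⟩ := (coe_eq_zero_iff (1 : ℝ)).1
    (show ((a - b : ℝ) : AddCircle (1 : ℝ)) = 0 by rw [coe_sub, h, sub_self])
  exact ⟨n, by simpa using hn.symm⟩

theorem eq_of_coe_eq_of_abs_sub_lt {a b : ℝ} (h : (a : AddCircle (1 : ℝ)) = b)
    (hab : |a - b| < 1) : a = b := by
  obtain ⟨n, hn⟩ := exists_intCast_eq h
  rw [hn] at hab
  have : n = 0 := Int.abs_lt_one_iff.1 (by exact_mod_cast hab)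
  rw [this, Int.cast_zero] at hn
  linarith

end AddCircle

/-! ### Continuity with respect to `c_r` -/

namespace CechClosure

/-- Failure of the `ε`-condition at `t` means that `t` lies in the closure of the set of bad points,
whose image stays at distance at least `r + ε` from `f t`. -/
theorem cont_ofMetric_iff {T Y : Type*} [TopologicalSpace T] [MetricSpace Y] {r : NNReal}
    {f : T → Y} : Cont (ofTop T) (ofMetric Y r) f ↔
      ∀ t, ∀ ε > 0, ∀ᶠ s in 𝓝 t, dist (f s) (f t) < r + ε := by
  constructor
  · intro h t ε hε
    by_contra hn
    have ht : t ∈ closure {s | ¬ dist (f s) (f t) < r + ε} :=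
      mem_closure_iff_frequently.2 (not_eventually.1 hn)
    have h1 : Metric.infEDist (f t) (f '' {s | ¬ dist (f s) (f t) < r + ε}) ≤ r :=
      h _ ⟨t, ht, rfl⟩
    have h2 : (r : ENNReal) < ENNReal.ofReal (r + ε) := by
      rw [← ENNReal.ofReal_coe_nnreal]
      exact (ENNReal.ofReal_lt_ofReal_iff (by positivity)).2 (by linarith)
    obtain ⟨_, ⟨s, hs, rfl⟩, hd⟩ := Metric.infEDist_lt_iff.1 (h1.trans_lt h2)
    refine hs ?_
    rw [edist_dist, dist_comm] at hd
    exact (ENNReal.ofReal_lt_ofReal_iff (by positivity)).1 hd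
  · rintro h A _ ⟨t, ht, rfl⟩
    change Metric.infEDist (f t) (f '' A) ≤ r
    refine ENNReal.le_of_forall_pos_le_add fun ε hε _ => ?_
    obtain ⟨s, hs, hA⟩ := ((mem_closure_iff_frequently.1 ht).and_eventually (h t ε hε)).exists
    refine (Metric.infEDist_le_edist_of_mem (Set.mem_image_of_mem f hs)).trans ?_
    rw [edist_dist, dist_comm, ← ENNReal.coe_add, ← ENNReal.ofReal_coe_nnreal]
    exact ENNReal.ofReal_le_ofReal (by push_cast; exact hA.le)

theorem cont_coe_addCircle {T : Type*} [TopologicalSpace T] {r : NNReal} {F : T → ℝ}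
    (hF : Cont (ofTop T) (ofMetric ℝ r) F) :
    Cont (ofTop T) (ofMetric (AddCircle (1 : ℝ)) r) (fun t => (F t : AddCircle (1 : ℝ))) := by
  rw [cont_ofMetric_iff] at *
  intro t ε hε
  filter_upwards [hF t ε hε] with s hs
  rw [dist_eq_norm, ← AddCircle.coe_sub]
  exact (AddCircle.norm_coe_le_abs _).trans_lt hs

theorem cont_ofMetric_of_continuous {T Y : Type*} [TopologicalSpace T] [MetricSpace Y] (r : NNReal)
    {f : T → Y} (hf : Continuous f) : Cont (ofTop T) (ofMetric Y r) f := by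
  rw [cont_ofMetric_iff]
  intro t ε hε
  filter_upwards [hf.continuousAt (Metric.ball_mem_nhds (f t) hε)] with s hs
  exact lt_of_lt_of_le hs (by simp)

theorem cont_add_const {T : Type*} [TopologicalSpace T] {r : NNReal} {F : T → ℝ} (a : ℝ)
    (hF : Cont (ofTop T) (ofMetric ℝ r) F) :
    Cont (ofTop T) (ofMetric ℝ r) (fun t => F t + a) := by
  rw [cont_ofMetric_iff] at *
  simpa using hF

/-- The jump in the `s`-direction is a convex combination of jumps of `F` and `G`, so it keeps the
bound `r`; the change in `t` contributes only a continuous term. -/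
theorem cont_lineHomotopy {r : NNReal} {F G : unitInterval → ℝ}
    (hF : Cont (ofTop unitInterval) (ofMetric ℝ r) F)
    (hG : Cont (ofTop unitInterval) (ofMetric ℝ r) G) :
    Cont (ofTop (unitInterval × unitInterval)) (ofMetric ℝ r)
      (fun z => (1 - (z.2 : ℝ)) * F z.1 + z.2 * G z.1) := by
  rw [cont_ofMetric_iff] at *
  rintro ⟨s, t⟩ ε hε
  have h3 : ∀ᶠ z : unitInterval × unitInterval in 𝓝 (s, t),
      |((z.2 : ℝ) - t) * (G s - F s)| < ε / 2 := by
    have hc : Continuous fun z : unitInterval × unitInterval =>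
        |((z.2 : ℝ) - t) * (G s - F s)| := by fun_prop
    exact hc.continuousAt.eventually_lt continuousAt_const (by simpa using half_pos hε)
  filter_upwards [continuousAt_fst.eventually (hF s (ε / 2) (half_pos hε)),
    continuousAt_fst.eventually (hG s (ε / 2) (half_pos hε)), h3] with z h1 h2 h3
  rw [Real.dist_eq] at *
  have e : (1 - (z.2 : ℝ)) * F z.1 + z.2 * G z.1 - ((1 - (t : ℝ)) * F s + t * G s) =
    ((1 - (z.2 : ℝ)) * (F z.1 - F s) + z.2 * (G z.1 - G s)) + ((z.2 : ℝ) - t) * (G s - F s) := by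
    ring
  have hz0 := z.2.2.1
  have hz1 := z.2.2.2
  rw [e]
  rw [abs_lt] at *
  constructor <;> nlinarith

/-! ### Existence of lifts -/

/-- `F` is a lift of `f : T → ℝ / ℤ` to the line, both carrying the closure operators `c_r`. -/
def IsLift {T : Type*} [TopologicalSpace T] (r : NNReal) (f : T → AddCircle (1 : ℝ))
    (F : T → ℝ) : Prop :=
  Cont (ofTop T) (ofMetric ℝ r) F ∧ ∀ t, (F t : AddCircle (1 : ℝ)) = f t

theorem IsLift.comp {T S : Type*} [TopologicalSpace T] [TopologicalSpace S] {r : NNReal}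
    {f : T → AddCircle (1 : ℝ)} {F : T → ℝ} (h : IsLift r f F) {u : S → T} (hu : Continuous u) :
    IsLift r (fun s => f (u s)) (fun s => F (u s)) :=
  ⟨h.1.comp (cont_ofTop hu), fun s => h.2 (u s)⟩

theorem IsLift.add_intCast {T : Type*} [TopologicalSpace T] {r : NNReal}
    {f : T → AddCircle (1 : ℝ)} {F : T → ℝ} (h : IsLift r f F) (n : ℤ) :
    IsLift r f (fun t => F t + n) :=
  ⟨cont_add_const _ h.1, fun t => by rw [AddCircle.coe_add, AddCircle.coe_intCast, add_zero, h.2]⟩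

/-- If all continuous maps `T → ℝ / ℤ` lift to the line, then so do the maps that are continuous
with respect to `c_r`, for `r < 1/3`: with a partition of unity, such a map is averaged to a
continuous map at distance less than `1/3`, and the lift of the latter is corrected. -/
theorem exists_isLift {T : Type*} [TopologicalSpace T] [CompactSpace T] [T2Space T] {r : NNReal}
    (hr : (r : ℝ) < 1 / 3)
    (hT : ∀ g : C(T, AddCircle (1 : ℝ)), ∃ G : C(T, ℝ), ∀ t, (G t : AddCircle (1 : ℝ)) = g t)
    {f : T → AddCircle (1 : ℝ)} (hf : Cont (ofTop T) (ofMetric _ r) f) : ∃ F, IsLift r f F := by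
  rw [cont_ofMetric_iff] at hf
  choose σ hσ hσn using AddCircle.exists_coe_eq_abs_eq_norm
  -- Both sides represent the same point of the circle, and they differ by less than `3 · 1/3 = 1`.
  have hσ_add : ∀ t u v, dist (f u) (f t) < 1 / 3 → dist (f v) (f t) < 1 / 3 →
      dist (f v) (f u) < 1 / 3 → σ (f u - f v) = σ (f u - f t) + σ (f t - f v) := by
    intro t u v h1 h2 h3
    apply AddCircle.eq_of_coe_eq_of_abs_sub_lt
    · rw [AddCircle.coe_add, hσ, hσ, hσ]; abel
    · rw [dist_eq_norm] at h1
      rw [dist_comm, dist_eq_norm] at h2 h3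
      rw [← hσn] at h1 h2 h3
      rw [abs_lt] at *
      constructor <;> linarith
  have hnear : ∀ t, ∃ U : Set T, IsOpen U ∧ t ∈ U ∧ ∀ s ∈ U, dist (f s) (f t) < 1 / 3 := by
    intro t
    obtain ⟨U, hU, ho, ht⟩ := eventually_nhds_iff.1 (hf t (1 / 3 - r) (by linarith))
    exact ⟨U, ho, ht, fun s hs => by simpa using hU s hs⟩
  choose U hUo hUt hU using hnear
  obtain ⟨b, hb⟩ := isCompact_univ.elim_finite_subcover U hUo
    (fun t _ => Set.mem_iUnion.2 ⟨t, hUt t⟩)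
  let e := b.equivFin
  let τ : Fin b.card → T := fun i => (e.symm i : T)
  obtain ⟨w, hw, hw1, -, -⟩ := exists_continuous_sum_one_of_isOpen_isCompact
    (s := fun i => U (τ i)) (fun i => hUo _) isCompact_univ (by
      intro t ht
      obtain ⟨u, hu, htu⟩ := Set.mem_iUnion₂.1 (hb ht)
      exact Set.mem_iUnion.2 ⟨e ⟨u, hu⟩, by simpa [τ] using htu⟩)
  have hw1 : ∀ t, ∑ i, w i t = 1 := fun t => by simpa using hw1 (Set.mem_univ t)
  -- the correction term and its continuous local model
  let D : T → ℝ := fun s => ∑ i, w i s * σ (f (τ i) - f s)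
  let C : T → T → ℝ := fun t s => ∑ i, w i s * σ (f (τ i) - f t)
  have hC : ∀ t, Continuous (C t) := fun t => by fun_prop
  -- Indices with `t` outside the support of `w i` drop out near `t`. For the others, `f (τ i)`, `f
  -- t` and `f s` are pairwise closer than `1/3`, so `σ` is additive, and the weights sum to `1`.
  have hDC : ∀ t, ∀ᶠ s in 𝓝 t, D s = C t s + σ (f t - f s) := by
    intro t
    have h1 : ∀ᶠ s in 𝓝 t, ∀ i, w i s * σ (f (τ i) - f s) =
        w i s * σ (f (τ i) - f t) + w i s * σ (f t - f s) := by
      rw [eventually_all]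
      intro i
      by_cases hi : t ∈ tsupport (w i)
      · filter_upwards [(hUo (τ i)).mem_nhds (hw i hi), (hUo t).mem_nhds (hUt t)] with s hs hs'
        rw [hσ_add t (τ i) s (by rw [dist_comm]; exact hU _ _ (hw i hi)) (hU _ _ hs') (hU _ _ hs),
          mul_add]
      · filter_upwards [(isClosed_tsupport (w i)).isOpen_compl.mem_nhds hi] with s hs
        rw [image_eq_zero_of_notMem_tsupport hs]
        simp
    filter_upwards [h1] with s hs
    simp only [D, C]
    rw [Finset.sum_congr rfl fun i _ => hs i, Finset.sum_add_distrib, ← Finset.sum_mul, hw1,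
      one_mul]
  have hD : ∀ t, D t = C t t := fun _ => rfl
  -- The term `σ (f t - f s)` in `D s` cancels the jump of `f`: near `t` the sum equals `f t + C t
  -- s`.
  have hg : Continuous fun s => f s + (D s : AddCircle (1 : ℝ)) := by
    rw [continuous_iff_continuousAt]
    intro t
    have : ContinuousAt (fun s => f t + (C t s : AddCircle (1 : ℝ))) t :=
      (continuous_const.add ((AddCircle.continuous_mk' (1 : ℝ)).comp (hC t))).continuousAt
    refine this.congr ?_
    filter_upwards [hDC t] with s hs
    rw [hs, AddCircle.coe_add, hσ]
    abel
  obtain ⟨G, hG⟩ := hT ⟨_, hg⟩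
  refine ⟨fun s => G s - D s, ?_, fun t => by rw [AddCircle.coe_sub, hG]; simp⟩
  rw [cont_ofMetric_iff]
  intro t ε hε
  -- Near `t`, `G - D` is the continuous `G - C t` minus `σ (f t - f s)`, whose size is the distance
  -- from `f s` to `f t`.
  have h1 : ∀ᶠ s in 𝓝 t, |(G s - C t s) - (G t - C t t)| < ε / 2 := by
    have hc : Continuous fun s => |(G s - C t s) - (G t - C t t)| := by
      have := hC t
      fun_prop
    exact hc.continuousAt.eventually_lt continuousAt_const (by simpa using half_pos hε)
  filter_upwards [h1, hDC t, hf t (ε / 2) (half_pos hε)] with s h1 h2 h3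
  rw [dist_comm, dist_eq_norm, ← hσn] at h3
  rw [Real.dist_eq, h2, hD]
  rw [abs_lt] at *
  constructor <;> linarith

open unitInterval in
-- Lift the edge where the first coordinate is `0` as a path, then apply homotopy lifting in the
-- first coordinate.
theorem exists_continuousMap_lift_square (g : C(I × I, AddCircle (1 : ℝ))) :
    ∃ G : C(I × I, ℝ), ∀ t, (G t : AddCircle (1 : ℝ)) = g t := by
  have cov := AddCircle.isCoveringMap_coe (1 : ℝ)
  obtain ⟨e, he⟩ := QuotientAddGroup.mk_surjective (g (0, 0))
  let γ : C(I, AddCircle (1 : ℝ)) := ⟨fun t => g (0, t), by fun_prop⟩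
  obtain ⟨Γ, hΓ, -⟩ := cov.exists_path_lifts γ e he.symm
  exact ⟨cov.liftHomotopy g Γ fun a => (congrFun hΓ a).symm,
    fun t => congrFun (cov.liftHomotopy_lifts g Γ _) t⟩

theorem exists_isLift_square {r : NNReal} (hr : (r : ℝ) < 1 / 3)
    {f : unitInterval × unitInterval → AddCircle (1 : ℝ)}
    (hf : Cont (ofTop _) (ofMetric _ r) f) : ∃ F, IsLift r f F :=
  exists_isLift hr exists_continuousMap_lift_square hf

theorem exists_isLift_interval {r : NNReal} (hr : (r : ℝ) < 1 / 3)
    {f : unitInterval → AddCircle (1 : ℝ)}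
    (hf : Cont (ofTop _) (ofMetric _ r) f) : ∃ F, IsLift r f F := by
  -- Pull back to the square along the projection, lift there, and restrict to a slice.
  obtain ⟨F, hF⟩ := exists_isLift_square hr (hf.comp (cont_ofTop continuous_fst))
  exact ⟨_, hF.comp (u := fun s : unitInterval => (s, 0)) (by fun_prop)⟩

/-! ### Uniqueness of lifts -/

theorem eq_of_coe_eq_zero_of_jumps_lt_one {T : Type*} [TopologicalSpace T] [PreconnectedSpace T]
    {D : T → ℝ} (h0 : ∀ t, (D t : AddCircle (1 : ℝ)) = 0)
    (hD : ∀ t, ∀ᶠ s in 𝓝 t, |D s - D t| < 1) (s t : T) : D s = D t := by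
  refine IsLocallyConstant.apply_eq_of_preconnectedSpace
    ((IsLocallyConstant.iff_eventually_eq D).2 fun t => ?_) s t
  filter_upwards [hD t] with s hs
  exact AddCircle.eq_of_coe_eq_of_abs_sub_lt ((h0 s).trans (h0 t).symm) hs

theorem IsLift.sub_eq_sub {T : Type*} [TopologicalSpace T] [PreconnectedSpace T] {r : NNReal}
    (hr : (r : ℝ) < 1 / 2) {f g : T → AddCircle (1 : ℝ)} {F G : T → ℝ} (hF : IsLift r f F)
    (hG : IsLift r g G) (hfg : ∀ t, f t = g t) (s t : T) : F s - G s = F t - G t := by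
  refine eq_of_coe_eq_zero_of_jumps_lt_one (D := fun t => F t - G t) ?_ ?_ s t
  · intro t
    rw [AddCircle.coe_sub, hF.2, hG.2, hfg, sub_self]
  · intro t
    -- With `ε = 1/2 - r` each lift jumps by less than `1/2`, so the difference jumps by less than
    -- `1`.
    filter_upwards [cont_ofMetric_iff.1 hF.1 t (1 / 2 - r) (by linarith),
      cont_ofMetric_iff.1 hG.1 t (1 / 2 - r) (by linarith)] with s h1 h2
    rw [Real.dist_eq] at h1 h2
    rw [abs_lt] at *
    constructor <;> linarith

/-! ### Winding numbers of loops -/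

namespace Loop

variable {r : NNReal} {x : AddCircle (1 : ℝ)}

theorem homotopic_of_isLift {f g : Loop (ofMetric (AddCircle (1 : ℝ)) r) x} {F G : unitInterval → ℝ}
    (hF : IsLift r f.toFun F) (hG : IsLift r g.toFun G) (h0 : F 0 = G 0) (h1 : F 1 = G 1) :
    f.Homotopic g := by
  rw [homotopic_iff]
  refine ⟨_, cont_coe_addCircle (cont_lineHomotopy hF.1 hG.1), fun s => ?_, fun s => ?_,
    fun t => ⟨?_, ?_⟩⟩
  · simp [hF.2]
  · simp [hG.2]
  · rw [← f.zero, ← hF.2]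
    congr 1
    simp only [h0]
    ring
  · rw [← f.one, ← hF.2]
    congr 1
    simp only [h1]
    ring

theorem Homotopic.isLift_sub_eq (hr : (r : ℝ) < 1 / 3)
    {f g : Loop (ofMetric (AddCircle (1 : ℝ)) r) x} (h : f.Homotopic g) {F G : unitInterval → ℝ}
    (hF : IsLift r f.toFun F) (hG : IsLift r g.toFun G) : F 1 - F 0 = G 1 - G 0 := by
  rw [homotopic_iff] at h
  obtain ⟨H, hc, h0, h1, hb⟩ := h
  obtain ⟨K, hK⟩ := exists_isLift_square hr hc
  have hr' : (r : ℝ) < 1 / 2 := by linarith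
  have e0 := (hK.comp (u := fun s : unitInterval => (s, 0)) (by fun_prop)).sub_eq_sub hr' hF h0 1 0
  have e1 := (hK.comp (u := fun s : unitInterval => (s, 1)) (by fun_prop)).sub_eq_sub hr' hG h1 1 0
  -- The two edges traced by the end points both lift the constant map at `x`, so `K (0, t) - K (1,
  -- t)` does not depend on `t`.
  have e2 := (hK.comp (u := fun t : unitInterval => (0, t)) (by fun_prop)).sub_eq_sub hr'
    (hK.comp (u := fun t : unitInterval => (1, t)) (by fun_prop))
    (fun t => (hb t).1.trans (hb t).2.symm) 1 0
  linarith

theorem isLift_star {f g : Loop (ofMetric (AddCircle (1 : ℝ)) r) x} {F G : unitInterval → ℝ}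
    (hF : IsLift r f.toFun F) (hG : IsLift r g.toFun G) (h : F 1 = G 0) :
    IsLift r (f.star g).toFun (fun t : unitInterval =>
      if (t : ℝ) ≤ 1 / 2 then F (clamp (2 * t)) else G (clamp (2 * t - 1))) := by
  refine ⟨cont_ite (1 / 2) continuous_subtype_val
      (hF.1.comp (cont_ofTop (continuous_clamp.comp (by fun_prop))))
      (hG.1.comp (cont_ofTop (continuous_clamp.comp (by fun_prop)))) ?_, fun t => ?_⟩
  · intro t ht
    rw [clamp_of_ge (by linarith), clamp_of_le (by linarith), h]
  · simp only [star]
    split_ifs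
    · exact hF.2 _
    · exact hG.2 _

/-- The loop at `x` that winds `n` times around the circle at constant speed. -/
noncomputable def winding (r : NNReal) (x : AddCircle (1 : ℝ)) (n : ℤ) :
    Loop (ofMetric (AddCircle (1 : ℝ)) r) x where
  toFun t := x + ((n * t : ℝ) : AddCircle (1 : ℝ))
  cont := cont_ofMetric_of_continuous r
    (continuous_const.add ((AddCircle.continuous_mk' (1 : ℝ)).comp (by fun_prop)))
  zero := by simp
  one := by simp [AddCircle.coe_intCast]

theorem isLift_winding {a : ℝ} (ha : (a : AddCircle (1 : ℝ)) = x) (n : ℤ) :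
    IsLift r (winding r x n).toFun (fun t => a + n * t) :=
  ⟨cont_ofMetric_of_continuous r (by fun_prop), fun t => by rw [AddCircle.coe_add, ha]; rfl⟩

theorem winding_star_winding (m n : ℤ) :
    ((winding r x m).star (winding r x n)).Homotopic (winding r x (m + n)) := by
  obtain ⟨a, rfl⟩ := QuotientAddGroup.mk_surjective x
  -- The second lift is shifted by `m` so that it starts at `a + m`, where the first one ends.
  refine homotopic_of_isLift (isLift_star (isLift_winding (a := a) rfl m)
    ((isLift_winding (a := a) rfl n).add_intCast m) (by simp)) (isLift_winding (a := a) rfl _) ?_ ?_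
  · simp [clamp_of_le]
  · simp only [Set.Icc.coe_one]
    rw [if_neg (by norm_num), clamp_of_ge (by norm_num)]
    push_cast [Set.Icc.coe_one]
    ring

theorem exists_homotopic_winding (hr : (r : ℝ) < 1 / 3)
    (f : Loop (ofMetric (AddCircle (1 : ℝ)) r) x) : ∃ n, (winding r x n).Homotopic f := by
  obtain ⟨F, hF⟩ := exists_isLift_interval hr f.cont
  have h0 : (F 0 : AddCircle (1 : ℝ)) = x := (hF.2 0).trans f.zero
  have h1 : (F 1 : AddCircle (1 : ℝ)) = x := (hF.2 1).trans f.one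
  obtain ⟨n, hn⟩ := AddCircle.exists_intCast_eq (h1.trans h0.symm)
  exact ⟨n, homotopic_of_isLift (isLift_winding h0 n) hF (by simp) (by simp [← hn])⟩

theorem eq_of_winding_homotopic (hr : (r : ℝ) < 1 / 3) {m n : ℤ}
    (h : (winding r x m).Homotopic (winding r x n)) : m = n := by
  obtain ⟨a, rfl⟩ := QuotientAddGroup.mk_surjective x
  simpa using h.isLift_sub_eq hr (isLift_winding (a := a) rfl m) (isLift_winding (a := a) rfl n)

end Loop

end CechClosure

/-! ### The isomorphism with the integers -/

theorem mainTheorem3 (r : NNReal) (hr : (r : ℝ) < 1 / 3) (x : AddCircle (1 : ℝ)) :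
    Nonempty (CechClosure.FundGroup (CechClosure.ofMetric (AddCircle (1 : ℝ)) r) x ≃*
      Multiplicative ℤ) := by
  let φ : Multiplicative ℤ →*
      CechClosure.FundGroup (CechClosure.ofMetric (AddCircle (1 : ℝ)) r) x :=
    MonoidHom.mk' (fun n => Quotient.mk (CechClosure.loopSetoid _ x)
      (CechClosure.Loop.winding r x n.toAdd))
      fun m n => (Quotient.sound (CechClosure.Loop.winding_star_winding m.toAdd n.toAdd)).symm
  refine ⟨(MulEquiv.ofBijective φ ⟨fun m n h => ?_, ?_⟩).symm⟩
  · exact CechClosure.Loop.eq_of_winding_homotopic hr (Quotient.exact h)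
  · rintro ⟨f⟩
    obtain ⟨n, hn⟩ := CechClosure.Loop.exists_homotopic_winding hr f
    exact ⟨Multiplicative.ofAdd n, Quotient.sound hn⟩
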